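/- Let $V\in L^p(\mathbb{R}^d,\mathbb{R})$, where $2\le p\le\infty$ and $p>d/2$. Let $A_0 u=i\Delta u$ with domain $D(A_0)=H^2(\mathbb{R}^d)\subset L^2(\mathbb{R}^d)=L^2(\mathbb{R}^d,\mathbb{C})$, where $\Delta$ is the distributional Laplacian, let $V$ also denote multiplication by $V$ with domain $D(V)=\{u\in L^2(\mathbb{R}^d): Vu\in L^2(\mathbb{R}^d)\}$, and let $A_0-iV$ be defined on $D(A_0)\cap D(V)$. Then $D(A_0-iV)=H^2(\mathbb{R}^d)$, and $A_0-iV$ is the infinitesimal generator of a strongly continuous one-parameter unitary group on $L^2(\mathbb{R}^d)$. That is, there is a family $(U(t))_{t\in\mathbb{R}}$ of unitary operators on $L^2(\mathbb{R}^d)$ with $U(0)=1$, $U(t+s)=U(t)U(s)$ for all $t,s\in\mathbb{R}$, and $t\mapsto U(t)\varphi$ continuous for every $\varphi\in L^2(\mathbb{R}^d)$, such that the domain of $A_0-iV$ is exactly the set of those $\psi\in L^2(\mathbb{R}^d)$ for which $\lim_{t\to0}\frac{U(t)\psi-\psi}{t}$ exists in $L^2(\mathbb{R}^d)$, and this limit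 equals $(A_0-iV)\psi$ for every such $\psi$. -/

import Mathlib

open MeasureTheory Filter Topology
open scoped ENNReal Laplacian SchwartzMap

noncomputable section

namespace Schrodinger

/-- The complex Hilbert space `L²(ℝᵈ)`. -/
abbrev L2 (d : ℕ) : Type :=
  Lp ℂ 2 (volume : Measure (EuclideanSpace ℝ (Fin d)))

/-- An `L²` function is determined by the tempered distribution that it defines. -/
theorem toTemperedDistribution_injective (d : ℕ) {f g : L2 d}
    (h : Lp.toTemperedDistribution f = Lp.toTemperedDistribution g) : f = g := by
  have hk := Lp.ker_toTemperedDistributionCLM_eq_bot (F := ℂ) (p := 2)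
    (μ := (volume : Measure (EuclideanSpace ℝ (Fin d))))
  exact (LinearMap.ker_eq_bot.mp hk) h

/-- The Sobolev space `H²(ℝᵈ)`, as a subspace of `L²(ℝᵈ)`: the `u ∈ L²` for which
`(1 + |η|²) û(η)` is in `L²`. -/
def H2 (d : ℕ) : Submodule ℂ (L2 d) where
  carrier := {u | TemperedDistribution.MemSobolev 2 2 (Lp.toTemperedDistribution u)}
  zero_mem' := by simp [← Lp.toTemperedDistributionCLM_apply]
  add_mem' {u v} hu hv := by
    have h := TemperedDistribution.MemSobolev.add hu hv
    simpa [← Lp.toTemperedDistributionCLM_apply] using h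
  smul_mem' c u hu := by
    have h := TemperedDistribution.MemSobolev.smul c hu
    simpa [← Lp.toTemperedDistributionCLM_apply] using h

/-- The distributional Laplacian of an `H²` function is represented by an `L²` function. -/
theorem exists_laplacian {d : ℕ} (u : H2 d) :
    ∃ g : L2 d, Δ (Lp.toTemperedDistribution (u : L2 d)) = Lp.toTemperedDistribution g := by
  have h : TemperedDistribution.MemSobolev 2 2 (Lp.toTemperedDistribution (u : L2 d)) := u.2
  have h' := h.laplacian
  rw [sub_self, TemperedDistribution.memSobolev_zero_iff] at h'
  exact h'

/-- The `L²` function that represents the distributional Laplacian of `u ∈ H²`. -/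
def laplacianFun {d : ℕ} (u : H2 d) : L2 d :=
  (exists_laplacian u).choose

theorem toTemperedDistribution_laplacianFun {d : ℕ} (u : H2 d) :
    Lp.toTemperedDistribution (laplacianFun u) = Δ (Lp.toTemperedDistribution (u : L2 d)) :=
  (exists_laplacian u).choose_spec.symm

/-- The Laplacian in `L²(ℝᵈ)` with domain `H²(ℝᵈ)`. -/
def laplacian (d : ℕ) : L2 d →ₗ.[ℂ] L2 d where
  domain := H2 d
  toFun :=
    { toFun := laplacianFun
      map_add' := fun u v => by
        apply toTemperedDistribution_injective
        have hu := toTemperedDistribution_laplacianFun u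
        have hv := toTemperedDistribution_laplacianFun v
        have huv := toTemperedDistribution_laplacianFun (u + v)
        simp only [← Lp.toTemperedDistributionCLM_apply, Submodule.coe_add, map_add,
          ← TemperedDistribution.laplacianCLM_apply] at hu hv huv ⊢
        rw [huv, hu, hv]
      map_smul' := fun c u => by
        apply toTemperedDistribution_injective
        have hu := toTemperedDistribution_laplacianFun u
        have hcu := toTemperedDistribution_laplacianFun (c • u)
        simp only [← Lp.toTemperedDistributionCLM_apply, Submodule.coe_smul, map_smul,
          ← TemperedDistribution.laplacianCLM_apply, RingHom.id_apply] at hu hcu ⊢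
        rw [hcu, hu] }

/-- The operator `A₀ = i Δ` with domain `H²(ℝᵈ)`. -/
def freeOperator (d : ℕ) : L2 d →ₗ.[ℂ] L2 d :=
  Complex.I • laplacian d

/-- The maximal domain `{u ∈ L² : V u ∈ L²}` of the multiplication by `V`. -/
def potentialDomain {d : ℕ} (V : EuclideanSpace ℝ (Fin d) → ℝ) : Submodule ℂ (L2 d) where
  carrier := {u | MemLp (fun x => (V x : ℂ) * u x) 2 volume}
  zero_mem' := by
    have h : MemLp (fun _ : EuclideanSpace ℝ (Fin d) => (0 : ℂ)) 2 volume := MemLp.zero'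
    refine h.ae_eq ?_
    filter_upwards [Lp.coeFn_zero ℂ 2 (volume : Measure (EuclideanSpace ℝ (Fin d)))] with x hx
    rw [hx, Pi.zero_apply, mul_zero]
  add_mem' {u v} hu hv := by
    refine (MemLp.add hu hv).ae_eq ?_
    filter_upwards [Lp.coeFn_add u v] with x hx
    rw [hx, Pi.add_apply, Pi.add_apply, mul_add]
  smul_mem' c u hu := by
    refine (MemLp.const_smul hu c).ae_eq ?_
    filter_upwards [Lp.coeFn_smul c u] with x hx
    rw [hx, Pi.smul_apply, Pi.smul_apply, mul_smul_comm]

theorem memLp_of_mem_potentialDomain {d : ℕ} {V : EuclideanSpace ℝ (Fin d) → ℝ}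
    (u : potentialDomain V) :
    MemLp (fun x => (V x : ℂ) * (u : L2 d) x) 2 (volume : Measure (EuclideanSpace ℝ (Fin d))) :=
  u.2

/-- Multiplication by the real potential `V`, with its maximal domain. -/
def potentialOperator {d : ℕ} (V : EuclideanSpace ℝ (Fin d) → ℝ) : L2 d →ₗ.[ℂ] L2 d where
  domain := potentialDomain V
  toFun :=
    { toFun := fun u => (memLp_of_mem_potentialDomain u).toLp
      map_add' := fun u v => by
        rw [← MemLp.toLp_add]
        apply MemLp.toLp_congr
        filter_upwards [Lp.coeFn_add (u : L2 d) (v : L2 d)] with x hx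
        rw [Submodule.coe_add, hx, Pi.add_apply, Pi.add_apply, mul_add]
      map_smul' := fun c u => by
        rw [RingHom.id_apply, ← MemLp.toLp_const_smul]
        apply MemLp.toLp_congr
        filter_upwards [Lp.coeFn_smul c (u : L2 d)] with x hx
        rw [Submodule.coe_smul, hx, Pi.smul_apply, Pi.smul_apply, mul_smul_comm] }

/-- The operator `A₀ - i V`, with domain the intersection of the domains of `A₀` and `V`. -/
def schrodingerOperator {d : ℕ} (V : EuclideanSpace ℝ (Fin d) → ℝ) : L2 d →ₗ.[ℂ] L2 d :=
  freeOperator d - Complex.I • potentialOperator V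

/-- A strongly continuous one-parameter unitary group on a Hilbert space. -/
structure IsUnitaryGroup {H : Type*} [NormedAddCommGroup H] [InnerProductSpace ℂ H]
    [CompleteSpace H] (U : ℝ → H →L[ℂ] H) : Prop where
  unitary : ∀ t, U t ∈ unitary (H →L[ℂ] H)
  map_zero : U 0 = 1
  map_add : ∀ t s, U (t + s) = U t * U s
  continuous : ∀ φ, Continuous fun t => U t φ

/-- `A` is the infinitesimal generator of `U`: the domain of `A` consists of exactly those `ψ` for
which `(U(t) ψ - ψ) / t` converges as `t → 0`, `t ≠ 0`, and `A ψ` is the limit. -/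
def IsInfinitesimalGenerator {H : Type*} [NormedAddCommGroup H] [InnerProductSpace ℂ H]
    (A : H →ₗ.[ℂ] H) (U : ℝ → H →L[ℂ] H) : Prop :=
  ∀ ψ φ : H, (ψ, φ) ∈ A.graph ↔
    Tendsto (fun t : ℝ => (t : ℂ)⁻¹ • (U t ψ - ψ)) (𝓝[≠] 0) (𝓝 φ)

end Schrodinger

end

/-! By a resolvent form of Stone's theorem (`IsSkewSymmetric.exists_isUnitaryGroup`), a
skew-symmetric `T` generates a unitary group once `c - T` is onto for all real `c` of large modulus:
skew-symmetry bounds the resolvents by `1/|c|`, and `T` is the strong limit of commuting bounded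
skew-adjoint operators whose exponentials converge. For `iΔ`, surjectivity is division by a Fourier
symbol with real part `c`. Kato–Rellich (`IsSkewSymmetric.exists_smul_sub_eq`) carries it over to
`iΔ - iV`, given `‖Vu‖ ≤ ½‖Δu‖ + b‖u‖` on `H²`. This bound also puts `H²` inside `D(V)`, which
settles the domain.

The bound (`exists_eLpNorm_mul_le`) is where `p > d/2` enters. If `f` has frequencies in `1 + |ξ|² ≤
R`, Bernstein's inequality and a truncation of `V` give `‖Vf‖ ≤ C R^θ ‖f‖` with `θ = d/(2p) < 1`.
Cut `u` into dyadic shells `1 + |ξ|² ~ 2^k`: multiplication by `V` costs `2^(θk)`, while the `H²`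
weight gains `2^(-k)`, so the shells sum geometrically. The far shells contribute at most half of
`‖u‖ + ‖Δu‖`, the low frequencies a multiple of `‖u‖`. -/

namespace Schrodinger

/-! ### Unitary groups as limits of exponentials of bounded operators -/

section UnitaryGroup

variable {H : Type*} [NormedAddCommGroup H] [InnerProductSpace ℂ H] [CompleteSpace H]

theorem exp_smul_mem_unitary {A : H →L[ℂ] H} (hA : A ∈ skewAdjoint (H →L[ℂ] H)) (t : ℝ) :
    NormedSpace.exp (t • A) ∈ unitary (H →L[ℂ] H) := by
  let _ : NormedAlgebra ℚ (H →L[ℂ] H) := NormedAlgebra.restrictScalars ℚ ℂ _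
  apply NormedSpace.exp_mem_unitary_of_mem_skewAdjoint
  rw [skewAdjoint.mem_iff] at hA ⊢
  rw [star_smul, hA, star_trivial, smul_neg]

theorem norm_apply_of_mem_unitary {U : H →L[ℂ] H} (hU : U ∈ unitary (H →L[ℂ] H)) (x : H) :
    ‖U x‖ = ‖x‖ :=
  ((ContinuousLinearMap.norm_map_iff_adjoint_comp_self U).mpr (Unitary.star_mul_self_of_mem hU)) x

theorem norm_exp_smul_apply {A : H →L[ℂ] H} (hA : A ∈ skewAdjoint (H →L[ℂ] H)) (t : ℝ) (x : H) :
    ‖NormedSpace.exp (t • A) x‖ = ‖x‖ :=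
  norm_apply_of_mem_unitary (exp_smul_mem_unitary hA t) x

theorem hasDerivAt_exp_smul_apply (A : H →L[ℂ] H) (x : H) (t : ℝ) :
    HasDerivAt (fun s : ℝ => NormedSpace.exp (s • A) x) (NormedSpace.exp (t • A) (A x)) t := by
  have h := (hasDerivAt_exp_smul_const (𝕂 := ℝ) A t).hasFDerivAt
  have h2 := ((ContinuousLinearMap.apply ℂ H x).restrictScalars ℝ).hasFDerivAt.comp t h
  simpa [Function.comp_def] using! h2.hasDerivAt

theorem norm_exp_smul_apply_sub_le {A : H →L[ℂ] H} (hA : A ∈ skewAdjoint (H →L[ℂ] H)) (t : ℝ)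
    (x : H) : ‖NormedSpace.exp (t • A) x - x‖ ≤ ‖A x‖ * |t| := by
  have h := (convex_univ (𝕜 := ℝ) (E := ℝ)).norm_image_sub_le_of_norm_hasDerivWithin_le
    (f := fun s : ℝ => NormedSpace.exp (s • A) x)
    (f' := fun s => NormedSpace.exp (s • A) (A x)) (C := ‖A x‖) (x := 0) (y := t)
    (fun s _ => (hasDerivAt_exp_smul_apply A x s).hasDerivWithinAt)
    (fun s _ => (norm_exp_smul_apply hA s _).le) (Set.mem_univ _) (Set.mem_univ _)
  simpa using h

/-- Commutativity factors `exp (tA)` as `exp (tB) exp (t(A - B))`; the isometry `exp (tB)` drops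
out, leaving the mean value bound for `A - B`. -/
theorem norm_exp_smul_sub_exp_smul_le {A B : H →L[ℂ] H} (hA : A ∈ skewAdjoint (H →L[ℂ] H))
    (hB : B ∈ skewAdjoint (H →L[ℂ] H)) (hAB : Commute A B) (t : ℝ) (x : H) :
    ‖NormedSpace.exp (t • A) x - NormedSpace.exp (t • B) x‖ ≤ ‖A x - B x‖ * |t| := by
  have hc : Commute (t • B) (t • (A - B)) :=
    ((hAB.symm.sub_right (Commute.refl B)).smul_left t).smul_right t
  have h1 : NormedSpace.exp (t • A) = NormedSpace.exp (t • B) * NormedSpace.exp (t • (A - B)) := by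
    let _ : NormedAlgebra ℚ (H →L[ℂ] H) := NormedAlgebra.restrictScalars ℚ ℂ _
    rw [← NormedSpace.exp_add_of_commute hc, smul_sub, add_sub_cancel]
  have h2 := norm_exp_smul_apply_sub_le (sub_mem hA hB) t x
  rwa [h1, mul_apply_eq_comp, ← map_sub, norm_exp_smul_apply hB]

/-- Commuting bounded skew-adjoint operators that converge strongly on a dense subspace generate
unitary groups which converge to a unitary group. -/
theorem exists_isUnitaryGroup_of_tendsto {A : ℕ → H →L[ℂ] H}
    (hA : ∀ n, A n ∈ skewAdjoint (H →L[ℂ] H)) (hcomm : ∀ m n, Commute (A m) (A n))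
    {D : Set H} (hD : Dense D) {G : H → H}
    (hG : ∀ x ∈ D, Tendsto (fun n => A n x) atTop (𝓝 (G x))) :
    ∃ U : ℝ → H →L[ℂ] H, IsUnitaryGroup U ∧
      ∀ x ∈ D, HasDerivAt (fun t => U t x) (G x) 0 := by
  set E : ℕ → ℝ → H →L[ℂ] H := fun n t => NormedSpace.exp (t • A n) with hE
  have hEn (n t x) : ‖E n t x‖ = ‖x‖ := norm_exp_smul_apply (hA n) t x
  -- The exponentials are isometries, so replacing `x` by a nearby `y ∈ D` costs the same for all
  -- `n` and `t`; for `y`, convergence of `A n y` controls the difference uniformly for bounded `t`.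
  have hcauchy (x : H) (r : ℝ) :
      UniformCauchySeqOn (fun n t => E n t x) atTop (Metric.ball (0 : ℝ) r) := by
    rw [Metric.uniformCauchySeqOn_iff]
    intro ε hε
    obtain ⟨y, hyD, hy⟩ := hD.exists_dist_lt x (ε := ε / 4) (by positivity)
    have hr : 0 < |r| + 1 := by positivity
    obtain ⟨N, hN⟩ := Metric.cauchySeq_iff.mp (hG y hyD).cauchySeq (ε / 4 / (|r| + 1))
      (by positivity)
    refine ⟨N, fun m hm n hn t ht => ?_⟩
    have ht' : |t| ≤ |r| + 1 := by
      rw [mem_ball_zero_iff, Real.norm_eq_abs] at ht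
      linarith [le_abs_self r]
    have h1 := norm_exp_smul_sub_exp_smul_le (hA m) (hA n) (hcomm m n) t y
    have h2 : ‖A m y - A n y‖ * |t| ≤ ε / 4 / (|r| + 1) * (|r| + 1) := by
      have := hN m hm n hn
      rw [dist_eq_norm] at this
      gcongr
    rw [div_mul_cancel₀ _ hr.ne'] at h2
    have h3 : E m t x - E n t x = E m t (x - y) + (E m t y - E n t y) - E n t (x - y) := by
      simp only [map_sub]; abel
    rw [dist_eq_norm, h3]
    rw [dist_eq_norm] at hy
    calc _ ≤ ‖E m t (x - y)‖ + ‖E m t y - E n t y‖ + ‖E n t (x - y)‖ :=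
          (norm_sub_le _ _).trans (add_le_add_left (norm_add_le _ _) _)
      _ ≤ ‖x - y‖ + ε / 4 + ‖x - y‖ := by
        rw [hEn, hEn]; gcongr; exact h1.trans h2
      _ < ε := by linarith
  have hlim (t : ℝ) (x : H) : ∃ y, Tendsto (fun n => E n t x) atTop (𝓝 y) :=
    cauchySeq_tendsto_of_complete <| (hcauchy x (|t| + 1)).cauchySeq (x := t) <| by
      rw [mem_ball_zero_iff, Real.norm_eq_abs]; linarith
  choose u hu using hlim
  let U : ℝ → H →L[ℂ] H := fun t =>
    continuousLinearMapOfTendsto (E · t) (f := u t) (tendsto_pi_nhds.mpr (hu t))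
  have hU (t x) : Tendsto (fun n => E n t x) atTop (𝓝 (U t x)) := hu t x
  have hunif (x r) : TendstoUniformlyOn (fun n t => E n t x) (fun t => U t x) atTop
      (Metric.ball (0 : ℝ) r) :=
    (hcauchy x r).tendstoUniformlyOn_of_tendsto fun t _ => hU t x
  have hUn (t x) : ‖U t x‖ = ‖x‖ :=
    tendsto_nhds_unique (hU t x).norm (by simp only [hEn]; exact tendsto_const_nhds)
  have hU0 : U 0 = 1 := by
    ext x
    refine tendsto_nhds_unique (hU 0 x) ?_
    simp [hE]
  have hUadd (t s) : U (t + s) = U t * U s := by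
    ext x
    refine tendsto_nhds_unique (hU (t + s) x) ?_
    have h1 : Tendsto (fun n => E n t (E n s x - U s x)) atTop (𝓝 0) := by
      rw [tendsto_zero_iff_norm_tendsto_zero]
      simp only [hEn]
      exact tendsto_iff_norm_sub_tendsto_zero.mp (hU s x)
    have h2 := h1.add (hU t (U s x))
    rw [zero_add] at h2
    refine h2.congr fun n => ?_
    have : E n (t + s) = E n t * E n s := by
      let _ : NormedAlgebra ℚ (H →L[ℂ] H) := NormedAlgebra.restrictScalars ℚ ℂ _
      simp only [hE, add_smul]
      exact NormedSpace.exp_add_of_commute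
        (((Commute.refl (A n)).smul_left t).smul_right s)
    rw [this, mul_apply_eq_comp, map_sub, sub_add_cancel]
  have hstar (t) : star (U t) * U t = 1 :=
    (ContinuousLinearMap.norm_map_iff_adjoint_comp_self (U t)).mp (hUn t)
  refine ⟨U, ⟨fun t => ?_, hU0, hUadd, fun x => ?_⟩, fun x hx => ?_⟩
  -- An isometry with a right inverse is unitary.
  · have h1 : U t * U (-t) = 1 := by rw [← hUadd, add_neg_cancel, hU0]
    have h2 : star (U t) = U (-t) := by
      calc star (U t) = star (U t) * (U t * U (-t)) := by rw [h1, mul_one]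
        _ = U (-t) := by rw [← mul_assoc, hstar, one_mul]
    exact Unitary.mem_iff.mpr ⟨hstar t, by rw [h2, h1]⟩
  · rw [continuous_iff_continuousAt]
    intro t
    have hball : Metric.ball (0 : ℝ) (|t| + 1) ∈ 𝓝 t := by
      apply Metric.isOpen_ball.mem_nhds
      rw [mem_ball_zero_iff, Real.norm_eq_abs]; linarith
    exact ((hunif x (|t| + 1)).continuousOn (Frequently.of_forall fun n s _ =>
      (hasDerivAt_exp_smul_apply (A n) x s).continuousAt.continuousWithinAt)).continuousAt hball
  -- The derivatives `E n t (A n x)` converge uniformly in `t`, because `E n t` preserves the norm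
  -- of the error `A n x - G x`.
  · have h := hasDerivAt_of_tendstoUniformlyOn (f := fun n t => E n t x)
      (f' := fun n t => E n t (A n x)) (g := fun t => U t x) (g' := fun t => U t (G x))
      (l := atTop) (x := 0) (s := Metric.ball (0 : ℝ) 1) Metric.isOpen_ball ?_
      (Eventually.of_forall fun n t _ => hasDerivAt_exp_smul_apply (A n) x t)
      (fun t _ => hU t x) (by simp)
    · simpa [hU0] using h
    · rw [Metric.tendstoUniformlyOn_iff]
      intro ε hε
      filter_upwards [Metric.tendstoUniformlyOn_iff.mp (hunif (G x) 1) (ε / 2) (by positivity),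
        Metric.tendsto_nhds.mp (hG x hx) (ε / 2) (by positivity)] with n h1 h2 t ht
      calc dist (U t (G x)) (E n t (A n x))
          ≤ dist (U t (G x)) (E n t (G x)) + dist (E n t (G x)) (E n t (A n x)) :=
            dist_triangle _ _ _
        _ = dist (U t (G x)) (E n t (G x)) + dist (A n x) (G x) := by
            rw [dist_eq_norm (E n t (G x)), ← map_sub, hEn, dist_comm (A n x), dist_eq_norm (G x)]
        _ < ε := by linarith [h1 t ht]

end UnitaryGroup

/-! ### Skew-symmetric operators and their resolvents -/

section SkewSymmetric

variable {H : Type*} [NormedAddCommGroup H] [InnerProductSpace ℂ H]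

/-- A partially defined operator with `⟪T x, y⟫ = -⟪x, T y⟫` on its domain. -/
def IsSkewSymmetric (T : H →ₗ.[ℂ] H) : Prop :=
  ∀ x y : T.domain, inner ℂ (T x) (y : H) = -inner ℂ (x : H) (T y)

theorem IsSkewSymmetric.re_inner_eq_zero {T : H →ₗ.[ℂ] H} (hT : IsSkewSymmetric T)
    (x : T.domain) : RCLike.re (inner ℂ (T x) (x : H)) = 0 := by
  have h := congrArg RCLike.re (hT x x)
  rw [map_neg, inner_re_symm (x : H)] at h
  linarith

/-- The cross term is a multiple of `Re ⟪T x, x⟫ = 0`. Dropping either summant on the right gives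
the two lower bounds that follow. -/
theorem IsSkewSymmetric.norm_sq_smul_sub {T : H →ₗ.[ℂ] H} (hT : IsSkewSymmetric T)
    (c : ℝ) (x : T.domain) :
    ‖(c : ℂ) • (x : H) - T x‖ ^ 2 = c ^ 2 * ‖(x : H)‖ ^ 2 + ‖T x‖ ^ 2 := by
  rw [@norm_sub_sq ℂ, inner_smul_left, norm_smul, mul_pow, Complex.norm_real, Real.norm_eq_abs,
    sq_abs, Complex.conj_ofReal, RCLike.re_eq_complex_re, Complex.re_ofReal_mul]
  have := hT.re_inner_eq_zero x
  rw [inner_re_symm] at this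
  rw [RCLike.re_eq_complex_re] at this
  rw [this]; ring

theorem IsSkewSymmetric.abs_mul_norm_le {T : H →ₗ.[ℂ] H} (hT : IsSkewSymmetric T)
    (c : ℝ) (x : T.domain) : |c| * ‖(x : H)‖ ≤ ‖(c : ℂ) • (x : H) - T x‖ := by
  apply le_of_sq_le_sq _ (norm_nonneg _)
  rw [hT.norm_sq_smul_sub, mul_pow, sq_abs]
  linarith [sq_nonneg ‖T x‖]

theorem IsSkewSymmetric.norm_apply_le {T : H →ₗ.[ℂ] H} (hT : IsSkewSymmetric T)
    (c : ℝ) (x : T.domain) : ‖T x‖ ≤ ‖(c : ℂ) • (x : H) - T x‖ := by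
  apply le_of_sq_le_sq _ (norm_nonneg _)
  rw [hT.norm_sq_smul_sub]
  linarith [mul_nonneg (sq_nonneg c) (sq_nonneg ‖(x : H)‖)]

/-- The bounded inverse of `c - T`. -/
theorem IsSkewSymmetric.exists_resolvent {T : H →ₗ.[ℂ] H} (hT : IsSkewSymmetric T)
    {c : ℝ} (hc : c ≠ 0) (hs : ∀ y, ∃ x : T.domain, (c : ℂ) • (x : H) - T x = y) :
    ∃ R : H →L[ℂ] H, (∀ y, ∃ x : T.domain, (x : H) = R y ∧ (c : ℂ) • (x : H) - T x = y) ∧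
      (∀ x : T.domain, R ((c : ℂ) • (x : H) - T x) = x) ∧ ∀ y, ‖R y‖ ≤ |c|⁻¹ * ‖y‖ := by
  let S : T.domain →ₗ[ℂ] H := (c : ℂ) • T.domain.subtype - T.toFun
  have hS (x : T.domain) : S x = (c : ℂ) • (x : H) - T x := rfl
  have hinj : Function.Injective S := by
    rw [injective_iff_map_eq_zero]
    intro x hx
    have h := hT.abs_mul_norm_le c x
    rw [← hS, hx, norm_zero] at h
    have h0 : ‖(x : H)‖ = 0 := by
      have := abs_pos.mpr hc
      nlinarith [norm_nonneg (x : H)]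
    simpa using h0
  let e := LinearEquiv.ofBijective S ⟨hinj, hs⟩
  have he (x : T.domain) : e.symm ((c : ℂ) • (x : H) - T x) = x := e.symm_apply_apply x
  have he' (y : H) : (c : ℂ) • (e.symm y : H) - T (e.symm y) = y := e.apply_symm_apply y
  have hb (y : H) : ‖(e.symm y : H)‖ ≤ |c|⁻¹ * ‖y‖ := by
    rw [le_inv_mul_iff₀ (abs_pos.mpr hc)]
    simpa only [he'] using hT.abs_mul_norm_le c (e.symm y)
  exact ⟨(T.domain.subtype ∘ₗ e.symm.toLinearMap).mkContinuous _ hb,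
    fun y => ⟨e.symm y, rfl, he' y⟩, fun x => congrArg Subtype.val (he x), hb⟩

end SkewSymmetric

/-! ### Stone's theorem via Yosida approximation, and Kato–Rellich -/

section Generator

variable {H : Type*} [NormedAddCommGroup H] [InnerProductSpace ℂ H]

/-- If `y = c x - T x` is orthogonal to the domain, pairing it with `x` leaves `c ‖x‖² = 0`. -/
theorem IsSkewSymmetric.dense_domain [CompleteSpace H] {T : H →ₗ.[ℂ] H} (hT : IsSkewSymmetric T)
    {c : ℝ} (hc : c ≠ 0) (hs : ∀ y, ∃ x : T.domain, (c : ℂ) • (x : H) - T x = y) :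
    Dense (T.domain : Set H) := by
  rw [Submodule.dense_iff_topologicalClosure_eq_top,
    Submodule.topologicalClosure_eq_top_iff, Submodule.eq_bot_iff]
  intro y hy
  obtain ⟨x, rfl⟩ := hs y
  have h := congrArg RCLike.re ((Submodule.mem_orthogonal' _ _).mp hy x x.2)
  rw [inner_sub_left, map_sub, hT.re_inner_eq_zero, inner_smul_left, Complex.conj_ofReal,
    map_zero, sub_zero, RCLike.re_eq_complex_re, Complex.re_ofReal_mul] at h
  have h0 : ‖(x : H)‖ ^ 2 = 0 := by
    rw [@norm_sq_eq_re_inner ℂ]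
    exact (mul_eq_zero.mp h).resolve_left hc
  have h1 : x = 0 := by simpa using h0
  simp [h1]

theorem IsUnitaryGroup.tendsto_iff_hasDerivAt [CompleteSpace H] {U : ℝ → H →L[ℂ] H}
    (hU : IsUnitaryGroup U) {x y : H} :
    Tendsto (fun t : ℝ => (t : ℂ)⁻¹ • (U t x - x)) (𝓝[≠] 0) (𝓝 y) ↔
      HasDerivAt (fun t => U t x) y 0 := by
  rw [hasDerivAt_iff_tendsto_slope_zero]
  simp only [zero_add, hU.map_zero, one_apply_eq_self, ← Complex.ofReal_inv, Complex.coe_smul]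

/-- Differentiate the constant function `‖U t x‖²` at `0`. -/
theorem IsUnitaryGroup.re_inner_eq_zero [CompleteSpace H] {U : ℝ → H →L[ℂ] H}
    (hU : IsUnitaryGroup U) {x y : H} (h : HasDerivAt (fun t => U t x) y 0) :
    RCLike.re (inner ℂ y x) = 0 := by
  have h1 := h.inner ℂ h
  have h2 : (fun t => inner ℂ (U t x) (U t x)) = fun _ => inner ℂ x x := by
    ext t
    rw [inner_self_eq_norm_sq_to_K, inner_self_eq_norm_sq_to_K,
      norm_apply_of_mem_unitary (hU.unitary t)]
  rw [h2] at h1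
  have h3 := congrArg RCLike.re (h1.unique (hasDerivAt_const _ _))
  rw [hU.map_zero, one_apply_eq_self, _root_.map_add, inner_re_symm x,
    _root_.map_zero] at h3
  linarith

/-- The generator of `U` extends `T` and is itself skew, so `c` minus it is injective; since `c - T`
is already onto, the extension cannot be proper. -/
theorem IsUnitaryGroup.isInfinitesimalGenerator [CompleteSpace H] {U : ℝ → H →L[ℂ] H}
    (hU : IsUnitaryGroup U) {T : H →ₗ.[ℂ] H}
    {c : ℝ} (hc : c ≠ 0) (hs : ∀ y, ∃ x : T.domain, (c : ℂ) • (x : H) - T x = y)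
    (hTU : ∀ x : T.domain, HasDerivAt (fun t => U t (x : H)) (T x) 0) :
    IsInfinitesimalGenerator T U := by
  intro x y
  rw [hU.tendsto_iff_hasDerivAt, LinearPMap.mem_graph_iff]
  refine ⟨?_, fun h => ?_⟩
  · rintro ⟨x, rfl, rfl⟩
    exact hTU x
  obtain ⟨z, hz⟩ := hs ((c : ℂ) • x - y)
  have h1 : HasDerivAt (fun t => U t (x - z)) (y - T z) 0 := by
    refine (h.sub (hTU z)).congr_of_eventuallyEq (Eventually.of_forall fun t => ?_)
    simp
  have h2 := hU.re_inner_eq_zero h1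
  have h3 : y - T z = (c : ℂ) • (x - z) := by
    have h4 : y - T z = (c : ℂ) • x - ((c : ℂ) • x - y) - T z := by abel
    rw [h4, ← hz, smul_sub]; abel
  rw [h3, inner_smul_left, Complex.conj_ofReal, RCLike.re_eq_complex_re,
    Complex.re_ofReal_mul] at h2
  have h5 : ‖x - z‖ ^ 2 = 0 := by
    rw [@norm_sq_eq_re_inner ℂ]
    exact (mul_eq_zero.mp h2).resolve_left hc
  have h6 : x - z = 0 := by simpa using h5
  rw [h6, smul_zero] at h3
  exact ⟨z, (sub_eq_zero.mp h6).symm, (sub_eq_zero.mp h3).symm⟩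

/-- A skew-symmetric operator for which `c - T` is onto for all real `c` of large modulus
generates a unitary group. -/
theorem IsSkewSymmetric.exists_isUnitaryGroup [CompleteSpace H] {T : H →ₗ.[ℂ] H}
    (hT : IsSkewSymmetric T) {c₀ : ℝ} (hc₀ : 0 < c₀)
    (hs : ∀ c : ℝ, c₀ ≤ |c| → ∀ y, ∃ x : T.domain, (c : ℂ) • (x : H) - T x = y) :
    ∃ U : ℝ → H →L[ℂ] H, IsUnitaryGroup U ∧ IsInfinitesimalGenerator T U := by
  classical
  have hne {c : ℝ} (hc : c₀ ≤ |c|) : c ≠ 0 := abs_pos.mp (hc₀.trans_le hc)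
  have hdense : Dense (T.domain : Set H) :=
    hT.dense_domain hc₀.ne' (hs c₀ (le_abs_self c₀))
  choose! R hR using fun (c : ℝ) (hc : c₀ ≤ |c|) => hT.exists_resolvent (hne hc) (hs c hc)
  -- The resolvent identity: apply `R c'` to `(c' - T) x = (c' - c) x + y`, where `x = R c y`.
  have hcomm' {c c' : ℝ} (hc : c₀ ≤ |c|) (hc' : c₀ ≤ |c'|) :
      R c = ((c' - c : ℝ) : ℂ) • (R c' * R c) + R c' := by
    ext y
    obtain ⟨x, hx, hxy⟩ := (hR c hc).1 y
    have h := (hR c' hc').2.1 x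
    have h1 : (c' : ℂ) • (x : H) - T x = ((c' - c : ℝ) : ℂ) • (x : H) + y := by
      rw [← hxy, Complex.ofReal_sub, sub_smul]; abel
    rw [h1, map_add, map_smul, hx] at h
    exact h.symm
  have hcomm {c c' : ℝ} (hc : c₀ ≤ |c|) (hc' : c₀ ≤ |c'|) : Commute (R c) (R c') := by
    by_cases h : c = c'
    · rw [h]
    have h1 := hcomm' hc hc'
    have h2 := hcomm' hc' hc
    have h3 : ((c' - c : ℝ) : ℂ) • (R c' * R c) = ((c' - c : ℝ) : ℂ) • (R c * R c') := by
      rw [eq_sub_of_add_eq h1.symm, ← neg_sub (R c'), eq_sub_of_add_eq h2.symm |>.symm, ← neg_smul,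
        ← Complex.ofReal_neg, neg_sub]
    have h4 : ((c' - c : ℝ) : ℂ) ≠ 0 := by
      exact_mod_cast sub_ne_zero.mpr (Ne.symm h)
    exact (smul_right_injective _ h4 h3).symm
  have hadj {c : ℝ} (hc : c₀ ≤ |c|) : star (R c) = -R (-c) := by
    rw [ContinuousLinearMap.star_eq_adjoint, eq_comm, ContinuousLinearMap.eq_adjoint_iff]
    intro y z
    obtain ⟨u, hu, huy⟩ := (hR (-c) (by rwa [abs_neg])).1 y
    obtain ⟨v, hv, hvz⟩ := (hR c hc).1 z
    rw [_root_.neg_apply, ← hu, ← hv, ← huy, ← hvz, inner_neg_left, inner_sub_left,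
      inner_sub_right, inner_smul_left, inner_smul_right, hT u v, Complex.conj_ofReal,
      Complex.ofReal_neg]
    ring
  -- With `λ = s (c₀ + n)`, on the domain `λ R(λ) x - x = R(λ) T x` has norm at most `‖T x‖ / |λ|`;
  -- density and `‖λ R(λ)‖ ≤ 1` extend the limit to all `y`. Both signs `s = ±1` are needed below.
  have hlim {s : ℝ} (hs1 : |s| = 1) (y : H) :
      Tendsto (fun n : ℕ => ((s * (c₀ + n) : ℝ) : ℂ) • R (s * (c₀ + n)) y) atTop (𝓝 y) := by
    have habs (n : ℕ) : |s * (c₀ + n)| = c₀ + n := by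
      rw [abs_mul, hs1, one_mul, abs_of_nonneg (by positivity)]
    have hle (n : ℕ) : c₀ ≤ |s * (c₀ + n)| := by
      rw [habs]; simp
    have hb (n : ℕ) (x : H) : ‖((s * (c₀ + n) : ℝ) : ℂ) • R (s * (c₀ + n)) x‖ ≤ ‖x‖ := by
      rw [norm_smul, Complex.norm_real, Real.norm_eq_abs]
      exact (le_inv_mul_iff₀ (hc₀.trans_le (hle n))).mp ((hR _ (hle n)).2.2 x)
    rw [Metric.tendsto_atTop]
    intro ε hε
    obtain ⟨x, hx, hxy⟩ := hdense.exists_dist_lt y (ε := ε / 3) (by positivity)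
    rw [dist_eq_norm] at hxy
    obtain ⟨N, hN⟩ := exists_nat_gt (‖T ⟨x, hx⟩‖ / (ε / 3))
    refine ⟨N, fun n hn => ?_⟩
    have h1 : ‖((s * (c₀ + n) : ℝ) : ℂ) • R (s * (c₀ + n)) x - x‖ < ε / 3 := by
      have h := (hR _ (hle n)).2.1 ⟨x, hx⟩
      rw [map_sub, map_smul, sub_eq_iff_eq_add'] at h
      rw [h, add_sub_cancel_right]
      refine ((hR _ (hle n)).2.2 _).trans_lt ?_
      have hn' : (N : ℝ) ≤ n := by exact_mod_cast hn
      rw [habs, inv_mul_lt_iff₀ (by positivity), ← div_lt_iff₀ (by positivity)]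
      linarith
    have h2 : ((s * (c₀ + n) : ℝ) : ℂ) • R (s * (c₀ + n)) y - y =
        ((s * (c₀ + n) : ℝ) : ℂ) • R (s * (c₀ + n)) (y - x) +
          (((s * (c₀ + n) : ℝ) : ℂ) • R (s * (c₀ + n)) x - x) - (y - x) := by
      rw [map_sub, smul_sub]; abel
    rw [dist_eq_norm, h2]
    calc _ ≤ ‖y - x‖ + ‖((s * (c₀ + n) : ℝ) : ℂ) • R (s * (c₀ + n)) x - x‖ + ‖y - x‖ :=
          (norm_sub_le _ _).trans
            (add_le_add_left ((norm_add_le _ _).trans (add_le_add_left (hb n _) _)) _)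
      _ < ε := by linarith
  let κ : ℕ → ℝ := fun n => c₀ + n
  have hκ (n) : c₀ ≤ |κ n| := by
    rw [abs_of_nonneg (by positivity)]; simp [κ]
  have hκ' (n) : c₀ ≤ |-κ n| := by rw [abs_neg]; exact hκ n
  -- Symmetrised Yosida approximation, formally `κ² T (κ² - T²)⁻¹`. Using both `κ` and `-κ` makes it
  -- skew-adjoint, as `R(κ)* = -R(-κ)`. On the domain it equals `½ (κ R(κ) + (-κ) R(-κ)) T`, which
  -- tends to `T`.
  let A : ℕ → H →L[ℂ] H := fun n => ((κ n ^ 2 / 2 : ℝ) : ℂ) • (R (κ n) + R (-κ n))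
  suffices h : (∀ n, A n ∈ skewAdjoint (H →L[ℂ] H)) ∧ (∀ m n, Commute (A m) (A n)) ∧
      ∀ x ∈ (T.domain : Set H), Tendsto (fun n => A n x) atTop
        (𝓝 (if h : x ∈ T.domain then T ⟨x, h⟩ else 0)) by
    obtain ⟨U, hU, hUd⟩ := exists_isUnitaryGroup_of_tendsto h.1 h.2.1 hdense h.2.2
    refine ⟨U, hU, hU.isInfinitesimalGenerator hc₀.ne' (hs c₀ (le_abs_self c₀)) fun x => ?_⟩
    simpa using hUd x x.2
  refine ⟨?_, ?_, ?_⟩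
  · intro n
    rw [skewAdjoint.mem_iff, star_smul, star_add, hadj (hκ n), hadj (hκ' n), neg_neg,
      RCLike.star_def, Complex.conj_ofReal, ← smul_neg, neg_add_rev (R (κ n))]
  · intro m n
    exact (((hcomm (hκ m) (hκ n)).add_left (hcomm (hκ' m) (hκ n))).add_right
      ((hcomm (hκ m) (hκ' n)).add_left (hcomm (hκ' m) (hκ' n)))).smul_left _ |>.smul_right _
  · intro x hx
    simp only [SetLike.mem_coe] at hx
    simp only [hx, dif_pos]
    have h1 := ((hlim (s := 1) (by simp) (T ⟨x, hx⟩)).add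
      (hlim (s := -1) (by simp) (T ⟨x, hx⟩))).const_smul ((1 / 2 : ℝ) : ℂ)
    have h2 : ((1 / 2 : ℝ) : ℂ) • (T ⟨x, hx⟩ + T ⟨x, hx⟩) = T ⟨x, hx⟩ := by
      rw [← two_smul ℂ, smul_smul]; norm_num
    rw [h2] at h1
    refine h1.congr fun n => ?_
    have h3 := (hR (κ n) (hκ n)).2.1 ⟨x, hx⟩
    have h4 := (hR (-κ n) (hκ' n)).2.1 ⟨x, hx⟩
    rw [map_sub, map_smul, sub_eq_iff_eq_add] at h3 h4
    simp only [one_mul, neg_one_mul, A, _root_.smul_apply, _root_.add_apply]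
    change _ • ((κ n : ℂ) • R (κ n) _ + ((-κ n : ℝ) : ℂ) • R (-κ n) _) = _
    have h5 : (κ n : ℂ) • (R (κ n) x + R (-κ n) x) =
        R (κ n) (T ⟨x, hx⟩) - R (-κ n) (T ⟨x, hx⟩) := by
      rw [Complex.ofReal_neg, neg_smul] at h4
      rw [smul_add, h3, ← neg_neg ((κ n : ℂ) • R (-κ n) x), h4]
      abel
    have h6 : ((κ n ^ 2 / 2 : ℝ) : ℂ) = ((1 / 2 : ℝ) : ℂ) * (κ n) * (κ n) := by
      push_cast; ring
    rw [h6, mul_smul, h5, mul_smul, smul_sub, Complex.ofReal_neg, neg_smul, sub_eq_add_neg]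

/-- A form of the Kato–Rellich theorem. -/
theorem IsSkewSymmetric.exists_smul_sub_eq [CompleteSpace H] {T S : H →ₗ.[ℂ] H}
    (hT : IsSkewSymmetric T)
    (hs : ∀ c : ℝ, c ≠ 0 → ∀ y, ∃ x : T.domain, (c : ℂ) • (x : H) - T x = y)
    (hTS : T.domain ≤ S.domain) {b : ℝ}
    (hb : ∀ x : T.domain, ‖S (Submodule.inclusion hTS x)‖ ≤ 1 / 2 * ‖T x‖ + b * ‖(x : H)‖)
    (hb0 : 0 ≤ b) {c : ℝ} (hc : 4 * b + 1 ≤ |c|) (y : H) :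
    ∃ x : (T - S).domain, (c : ℂ) • (x : H) - (T - S) x = y := by
  have hc1 : 0 < |c| := by linarith
  obtain ⟨R, hR, -, hRb⟩ := hT.exists_resolvent (abs_pos.mp hc1) (hs c (abs_pos.mp hc1))
  have hmem (z : H) : R z ∈ T.domain := by
    obtain ⟨x, hx, -⟩ := hR z
    exact hx ▸ x.2
  -- On the domain of `T`, `c - (T - S) = (1 + K)(c - T)` with `K = S R`. The relative bound gives
  -- `‖K‖ ≤ 1/2 + b/|c| ≤ 3/4`, so a Neumann series inverts `1 + K`.
  let K : H →ₗ[ℂ] H := S.toFun ∘ₗ Submodule.inclusion hTS ∘ₗ R.toLinearMap.codRestrict _ hmem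
  have hTR (z : H) : (c : ℂ) • R z - T ⟨R z, hmem z⟩ = z := by
    obtain ⟨x, hx, hxz⟩ := hR z
    rwa [← Subtype.ext (a1 := x) (a2 := ⟨R z, hmem z⟩) hx, ← hx]
  have hK (z : H) : ‖(-K) z‖ ≤ 3 / 4 * ‖z‖ := by
    rw [LinearMap.neg_apply, norm_neg]
    have h1 := hT.norm_apply_le c ⟨R z, hmem z⟩
    rw [hTR] at h1
    have h2 : b * ‖R z‖ ≤ 1 / 4 * ‖z‖ := by
      have h3 := (le_inv_mul_iff₀ hc1).mp (hRb z)
      nlinarith [norm_nonneg (R z)]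
    calc ‖K z‖ ≤ 1 / 2 * ‖T ⟨R z, hmem z⟩‖ + b * ‖R z‖ := hb ⟨R z, hmem z⟩
      _ ≤ 3 / 4 * ‖z‖ := by linarith
  obtain ⟨u, hu⟩ := isUnit_one_sub_of_norm_lt_one
    (x := (-K).mkContinuous _ hK) (((-K).mkContinuous_norm_le (by norm_num) hK).trans_lt
      (by norm_num))
  let z : H := (↑u⁻¹ : H →L[ℂ] H) y
  have hz : z + K z = y := by
    have h1 := congrArg (fun L : H →L[ℂ] H => L y) u.mul_inv
    simp only [mul_apply_eq_comp, one_apply_eq_self, hu] at h1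
    simpa using h1
  refine ⟨⟨R z, hmem z, hTS (hmem z)⟩, ?_⟩
  rw [← hz, LinearPMap.sub_apply, ← sub_add]
  exact congrArg (· + K z) (hTR z)

end Generator

/-! ### The free operator on the Fourier side, and Fourier inversion -/

section Fourier

open FourierTransform Real
open scoped ContDiff

variable {d : ℕ}

local notation "𝔼" => EuclideanSpace ℝ (Fin d)

theorem locallyIntegrable_L2 (f : L2 d) : LocallyIntegrable f volume :=
  (Lp.memLp f).locallyIntegrable (by norm_num)

theorem exists_schwartzMap_coe {φ : 𝔼 → ℝ} (hφ : ContDiff ℝ ∞ φ) (hφ' : HasCompactSupport φ) :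
    ∃ ψ : 𝓢(𝔼, ℂ), ∀ x, ψ x = φ x := by
  have hg₁ : HasCompactSupport (Complex.ofRealCLM ∘ φ) := hφ'.comp_left rfl
  have hg₂ : ContDiff ℝ ∞ (Complex.ofRealCLM ∘ φ) := by fun_prop
  exact ⟨hg₁.toSchwartzMap hg₂, fun x => rfl⟩

/-- Multiplication of distributions in `L²` by a function of temperate growth is pointwise
multiplication. -/
theorem smulLeftCLM_eq_iff {m : 𝔼 → ℂ} (hm : m.HasTemperateGrowth) (f g : L2 d) :
    TemperedDistribution.smulLeftCLM ℂ m (Lp.toTemperedDistribution f) =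
      Lp.toTemperedDistribution g ↔ ∀ᵐ x, g x = m x * f x := by
  constructor
  · intro h
    refine ae_eq_of_integral_contDiff_smul_eq (locallyIntegrable_L2 g)
      ((locallyIntegrable_L2 f).continuous_mul hm.1.continuous) fun φ hφ hφ' => ?_
    obtain ⟨ψ, hψ⟩ := exists_schwartzMap_coe hφ hφ'
    have h1 := congrArg (fun D : 𝓢'(𝔼, ℂ) => D ψ) h
    simp only [TemperedDistribution.smulLeftCLM_apply_apply, Lp.toTemperedDistribution_apply,
      SchwartzMap.smulLeftCLM_apply_apply hm, hψ] at h1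
    simp only [Complex.real_smul]
    simp only [smul_eq_mul] at h1
    rw [← h1]
    congr 1 with x
    ring
  · intro h
    ext ψ
    simp only [TemperedDistribution.smulLeftCLM_apply_apply, Lp.toTemperedDistribution_apply,
      SchwartzMap.smulLeftCLM_apply_apply hm]
    apply integral_congr_ae
    filter_upwards [h] with x hx
    rw [hx, smul_eq_mul, smul_eq_mul, smul_eq_mul]
    ring

theorem mem_H2_iff (u : L2 d) :
    u ∈ H2 d ↔ MemLp (fun x => ((1 + ‖x‖ ^ 2 : ℝ) : ℂ) * (𝓕 u : L2 d) x) 2 volume := by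
  have hm : (fun x : 𝔼 => (((1 + ‖x‖ ^ 2) ^ ((2 : ℝ) / 2) : ℝ) : ℂ)).HasTemperateGrowth := by
    fun_prop
  have h1 : u ∈ H2 d ↔ ∃ f' : L2 d, ∀ᵐ x, f' x =
      (((1 + ‖x‖ ^ 2) ^ ((2 : ℝ) / 2) : ℝ) : ℂ) * (𝓕 u : L2 d) x := by
    change TemperedDistribution.MemSobolev 2 2 (Lp.toTemperedDistribution u) ↔ _
    rw [TemperedDistribution.memSobolev_iff_exists_smulLeftCLM_fourier]
    simp only [Lp.fourier_toTemperedDistribution_eq, smulLeftCLM_eq_iff hm]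
  simp only [div_self (two_ne_zero' ℝ), rpow_one] at h1
  rw [h1]
  exact ⟨fun ⟨f', hf'⟩ => (memLp_congr_ae hf').mp (Lp.memLp f'),
    fun h => ⟨h.toLp, h.coeFn_toLp⟩⟩

theorem fourier_laplacian (u : H2 d) :
    ∀ᵐ x, (𝓕 (laplacianFun u) : L2 d) x =
      ((-(2 * π) ^ 2 * ‖x‖ ^ 2 : ℝ) : ℂ) * (𝓕 (u : L2 d) : L2 d) x := by
  have hm : (fun x : 𝔼 => ((‖x‖ ^ 2 : ℝ) : ℂ)).HasTemperateGrowth := by fun_prop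
  have hm' : (fun x : 𝔼 => ((-(2 * π) ^ 2 * ‖x‖ ^ 2 : ℝ) : ℂ)).HasTemperateGrowth := by fun_prop
  rw [← smulLeftCLM_eq_iff hm', ← Lp.fourier_toTemperedDistribution_eq,
    ← Lp.fourier_toTemperedDistribution_eq, toTemperedDistribution_laplacianFun,
    TemperedDistribution.laplacian_eq_fourierMultiplierCLM,
    TemperedDistribution.fourierMultiplierCLM_apply, ← Complex.coe_smul, fourier_smul,
    fourier_fourierInv_eq, ← smul_apply (M := ℂ), ← TemperedDistribution.smulLeftCLM_smul hm]
  congr 2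
  ext x
  simp

theorem norm_fourier_le {f g : L2 d} {c : ℝ}
    (h : ∀ᵐ x, ‖(𝓕 f : L2 d) x‖ ≤ c * ‖(𝓕 g : L2 d) x‖) : ‖f‖ ≤ c * ‖g‖ := by
  rw [← Lp.norm_fourier_eq f, ← Lp.norm_fourier_eq g]
  exact Lp.norm_le_mul_norm_of_ae_le_mul h

theorem isSkewSymmetric_freeOperator (d : ℕ) : IsSkewSymmetric (freeOperator d) := by
  intro u v
  change inner ℂ (Complex.I • laplacianFun u) (v : L2 d) =
    -inner ℂ (u : L2 d) (Complex.I • laplacianFun v)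
  have h : inner ℂ (laplacianFun u) (v : L2 d) = inner ℂ (u : L2 d) (laplacianFun v) := by
    rw [← Lp.inner_fourier_eq, ← Lp.inner_fourier_eq (u : L2 d), L2.inner_def, L2.inner_def]
    apply integral_congr_ae
    filter_upwards [fourier_laplacian u, fourier_laplacian v] with x hu hv
    simp only [hu, hv, RCLike.inner_apply, map_mul, Complex.conj_ofReal]
    ring
  rw [inner_smul_left, inner_smul_right, h, Complex.conj_I, neg_mul]

/-- The symbol of `c - iΔ` is `c + i (2π)² |ξ|²`. Its real part keeps the inverse `q` bounded; its
imaginary part keeps `|ξ|² q` bounded, which puts the solution in `H²`. -/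
theorem freeOperator_surjective {c : ℝ} (hc : c ≠ 0) (y : L2 d) :
    ∃ u : (freeOperator d).domain, (c : ℂ) • (u : L2 d) - freeOperator d u = y := by
  let q : 𝔼 → ℂ := fun x => (c + Complex.I * (((2 * π) ^ 2 * ‖x‖ ^ 2 : ℝ) : ℂ))⁻¹
  have hre (x : 𝔼) : (c + Complex.I * (((2 * π) ^ 2 * ‖x‖ ^ 2 : ℝ) : ℂ)).re = c := by
    rw [Complex.add_re, Complex.ofReal_re, Complex.I_mul_re, Complex.ofReal_im, neg_zero, add_zero]
  have him (x : 𝔼) : (c + Complex.I * (((2 * π) ^ 2 * ‖x‖ ^ 2 : ℝ) : ℂ)).im =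
      (2 * π) ^ 2 * ‖x‖ ^ 2 := by
    rw [Complex.add_im, Complex.ofReal_im, Complex.I_mul_im, Complex.ofReal_re, zero_add]
  have hne (x : 𝔼) : c + Complex.I * (((2 * π) ^ 2 * ‖x‖ ^ 2 : ℝ) : ℂ) ≠ 0 := by
    intro h
    have := hre x
    rw [h] at this
    exact hc this.symm
  have hqc : Continuous q := Continuous.inv₀ (by fun_prop) hne
  have hq1 (x : 𝔼) : ‖q x‖ ≤ |c|⁻¹ := by
    rw [norm_inv]
    refine inv_anti₀ (abs_pos.mpr hc) ?_
    have h1 := Complex.abs_re_le_norm (c + Complex.I * (((2 * π) ^ 2 * ‖x‖ ^ 2 : ℝ) : ℂ))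
    rwa [hre] at h1
  have hq2 (x : 𝔼) : ‖x‖ ^ 2 * ‖q x‖ ≤ 1 := by
    rw [norm_inv, mul_inv_le_iff₀ (norm_pos_iff.mpr (hne x)), one_mul]
    have h1 := Complex.abs_im_le_norm (c + Complex.I * (((2 * π) ^ 2 * ‖x‖ ^ 2 : ℝ) : ℂ))
    rw [him, abs_of_nonneg (by positivity)] at h1
    refine le_trans ?_ h1
    exact le_mul_of_one_le_left (sq_nonneg _) (by nlinarith [pi_gt_three])
  have hmeas : AEStronglyMeasurable (𝓕 y : L2 d) volume := Lp.aestronglyMeasurable _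
  have hg : MemLp (fun x => q x * (𝓕 y : L2 d) x) 2 volume := by
    refine (Lp.memLp (𝓕 y)).of_le_mul (c := |c|⁻¹) (hqc.aestronglyMeasurable.mul hmeas)
      (Eventually.of_forall fun x => ?_)
    rw [norm_mul]
    gcongr
    exact hq1 x
  let u : L2 d := 𝓕⁻ hg.toLp
  have hu : ∀ᵐ x, (𝓕 u : L2 d) x = q x * (𝓕 y : L2 d) x := by
    rw [show 𝓕 u = hg.toLp from fourier_fourierInv_eq _]
    exact hg.coeFn_toLp
  have huH : u ∈ H2 d := by
    rw [mem_H2_iff]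
    refine (Lp.memLp (𝓕 y)).of_le_mul (c := |c|⁻¹ + 1) ((by fun_prop : Continuous fun x : 𝔼 =>
      ((1 + ‖x‖ ^ 2 : ℝ) : ℂ)).aestronglyMeasurable.mul (Lp.aestronglyMeasurable _)) ?_
    filter_upwards [hu] with x hx
    rw [hx, ← mul_assoc, norm_mul, norm_mul, Complex.norm_real, Real.norm_eq_abs,
      abs_of_nonneg (by positivity)]
    gcongr
    linarith [hq1 x, hq2 x]
  refine ⟨⟨u, huH⟩, ?_⟩
  change (c : ℂ) • u - Complex.I • laplacianFun ⟨u, huH⟩ = y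
  apply (Lp.fourierTransformₗᵢ 𝔼 ℂ).injective
  rw [map_sub, map_smul, map_smul]
  change (c : ℂ) • (𝓕 u : L2 d) - Complex.I • (𝓕 (laplacianFun ⟨u, huH⟩) : L2 d) = 𝓕 y
  apply Lp.ext
  filter_upwards [hu, fourier_laplacian ⟨u, huH⟩,
    Lp.coeFn_sub ((c : ℂ) • (𝓕 u : L2 d)) (Complex.I • (𝓕 (laplacianFun ⟨u, huH⟩) : L2 d)),
    Lp.coeFn_smul (c : ℂ) (𝓕 u : L2 d),
    Lp.coeFn_smul Complex.I (𝓕 (laplacianFun ⟨u, huH⟩) : L2 d)] with x h1 h2 h3 h4 h5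
  rw [h3, Pi.sub_apply, h4, h5, Pi.smul_apply, Pi.smul_apply, h2, h1, smul_eq_mul, smul_eq_mul]
  have h6 : (c + Complex.I * (((2 * π) ^ 2 * ‖x‖ ^ 2 : ℝ) : ℂ)) * q x = 1 :=
    mul_inv_cancel₀ (hne x)
  calc _ = ((c + Complex.I * (((2 * π) ^ 2 * ‖x‖ ^ 2 : ℝ) : ℂ)) * q x) * (𝓕 y : L2 d) x := by
        push_cast; ring
    _ = _ := by rw [h6, one_mul]

theorem isSkewSymmetric_potentialOperator (V : 𝔼 → ℝ) :
    IsSkewSymmetric (Complex.I • potentialOperator V) := by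
  intro u v
  change inner ℂ (Complex.I • (memLp_of_mem_potentialDomain u).toLp) (v : L2 d) =
    -inner ℂ (u : L2 d) (Complex.I • (memLp_of_mem_potentialDomain v).toLp)
  have h : inner ℂ (memLp_of_mem_potentialDomain u).toLp (v : L2 d) =
      inner ℂ (u : L2 d) (memLp_of_mem_potentialDomain v).toLp := by
    rw [L2.inner_def, L2.inner_def]
    apply integral_congr_ae
    filter_upwards [(memLp_of_mem_potentialDomain u).coeFn_toLp,
      (memLp_of_mem_potentialDomain v).coeFn_toLp] with x hu hv
    simp only [hu, hv, RCLike.inner_apply, map_mul, Complex.conj_ofReal]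
    ring
  rw [inner_smul_left, inner_smul_right, h, Complex.conj_I, neg_mul]

theorem IsSkewSymmetric.sub {H : Type*} [NormedAddCommGroup H] [InnerProductSpace ℂ H]
    {T S : H →ₗ.[ℂ] H} (hT : IsSkewSymmetric T) (hS : IsSkewSymmetric S) :
    IsSkewSymmetric (T - S) := by
  intro x y
  rw [LinearPMap.sub_apply, LinearPMap.sub_apply, inner_sub_left, inner_sub_right]
  have h1 := hT ⟨x, x.2.1⟩ ⟨y, y.2.1⟩
  have h2 := hS ⟨x, x.2.2⟩ ⟨y, y.2.2⟩
  simp only at h1 h2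
  rw [h1, h2]
  ring

/-- The Fourier inversion formula for functions in `L²` with integrable Fourier transform. -/
theorem ae_eq_fourierInv_fourier (f : L2 d) (hf : Integrable (𝓕 f : L2 d) volume) :
    ∀ᵐ x, f x = 𝓕⁻ ((𝓕 f : L2 d) : 𝔼 → ℂ) x := by
  have hcont : Continuous (𝓕⁻ ((𝓕 f : L2 d) : 𝔼 → ℂ)) :=
    VectorFourier.fourierIntegral_continuous (L := -innerₗ 𝔼) continuous_fourierChar
      continuous_inner.neg hf
  refine ae_eq_of_integral_contDiff_smul_eq (locallyIntegrable_L2 f) hcont.locallyIntegrable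
    fun φ hφ hφ' => ?_
  obtain ⟨ψ, hψ⟩ := exists_schwartzMap_coe hφ hφ'
  have h1 : Lp.toTemperedDistribution f = 𝓕⁻ (Lp.toTemperedDistribution (𝓕 f : L2 d)) := by
    rw [Lp.fourierInv_toTemperedDistribution_eq, fourierInv_fourier_eq]
  have h2 := congrArg (fun D : 𝓢'(𝔼, ℂ) => D ψ) h1
  simp only [TemperedDistribution.fourierInv_apply, Lp.toTemperedDistribution_apply, hψ] at h2
  -- Fubini moves the inverse transform from the test function onto the integrable function `𝓕 f`.
  have h3 := VectorFourier.integral_fourierIntegral_smul_eq_flip (L := -innerₗ 𝔼)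
    continuous_fourierChar continuous_inner.neg ψ.integrable (μ := volume) hf
  have h4 : (-innerₗ 𝔼).flip = -innerₗ 𝔼 := by
    ext x y
    simp [real_inner_comm]
  rw [h4] at h3
  simp only [hψ] at h3
  simp only [Complex.real_smul]
  exact h2.trans (Eq.trans (by rw [SchwartzMap.fourierInv_coe]; rfl) h3)

theorem enorm_le_eLpNorm_fourier (f : L2 d) (hf : Integrable (𝓕 f : L2 d) volume) :
    ∀ᵐ x, ‖f x‖ₑ ≤ eLpNorm (𝓕 f : L2 d) 1 volume := by
  filter_upwards [ae_eq_fourierInv_fourier f hf] with x hx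
  rw [hx, eLpNorm_one_eq_lintegral_enorm]
  refine (enorm_integral_le_lintegral_enorm _).trans (lintegral_mono fun y => ?_)
  rw [← ofReal_norm, Circle.norm_smul, ofReal_norm]

end Fourier

/-! ### Multiplication by the potential on band-limited functions -/

section Potential

open FourierTransform Real

variable {d : ℕ}

local notation "𝔼" => EuclideanSpace ℝ (Fin d)

variable (d) in
/-- A form of Bernstein's inequality: a function in `L²` whose Fourier transform is supported in a
ball is bounded. -/
theorem exists_enorm_le_of_fourier_support :
    ∃ K : ℝ≥0∞, K ≠ ∞ ∧ ∀ (f : L2 d) (R : ℝ), 1 ≤ R →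
      (∀ᵐ ξ, (𝓕 f : L2 d) ξ ≠ 0 → 1 + ‖ξ‖ ^ 2 ≤ R) →
        ∀ᵐ x, ‖f x‖ₑ ≤ K * ENNReal.ofReal (R ^ ((d : ℝ) / 4)) * ‖f‖ₑ := by
  let B : ℝ≥0∞ := volume (Metric.ball (0 : 𝔼) 1)
  have hB : B ≠ ∞ := measure_ball_lt_top.ne
  refine ⟨B ^ (1 / 2 : ℝ), ENNReal.rpow_ne_top_of_nonneg (by norm_num) hB, fun f R hR hf => ?_⟩
  let s : Set 𝔼 := Metric.closedBall 0 (√R)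
  have hs : ∀ᵐ ξ, (𝓕 f : L2 d) ξ = s.indicator (𝓕 f : L2 d) ξ := by
    filter_upwards [hf] with ξ h
    by_cases h0 : (𝓕 f : L2 d) ξ = 0
    · rw [h0, Set.indicator_apply_eq_zero.mpr fun _ => h0]
    · rw [Set.indicator_of_mem]
      rw [mem_closedBall_zero_iff]
      exact Real.le_sqrt_of_sq_le (by linarith [h h0])
  have hvol : volume s = ENNReal.ofReal (R ^ ((d : ℝ) / 2)) * B := by
    rw [Measure.addHaar_closedBall _ _ (by positivity), finrank_euclideanSpace_fin,
      Real.sqrt_eq_rpow, ← Real.rpow_mul_natCast (by linarith)]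
    congr 3
    ring
  have : IsFiniteMeasure (volume.restrict s) :=
    ⟨by rw [Measure.restrict_apply_univ]; exact measure_closedBall_lt_top⟩
  have hsm : MeasurableSet s := Metric.isClosed_closedBall.measurableSet
  -- Cauchy–Schwarz on the ball of radius `√R`: the square root of its volume `R^(d/2) B` gives the
  -- factor `R^(d/4)`.
  have h1 : eLpNorm (𝓕 f : L2 d) 1 volume ≤
      B ^ (1 / 2 : ℝ) * ENNReal.ofReal (R ^ ((d : ℝ) / 4)) * ‖f‖ₑ := by
    calc eLpNorm (𝓕 f : L2 d) 1 volume = eLpNorm (𝓕 f : L2 d) 1 (volume.restrict s) := by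
          rw [eLpNorm_congr_ae hs, eLpNorm_indicator_eq_eLpNorm_restrict hsm]
      _ ≤ eLpNorm (𝓕 f : L2 d) 2 (volume.restrict s) *
          (volume.restrict s) Set.univ ^ (1 / (1 : ℝ≥0∞).toReal - 1 / (2 : ℝ≥0∞).toReal) :=
        eLpNorm_le_eLpNorm_mul_rpow_measure_univ (by norm_num)
          (Lp.aestronglyMeasurable _).restrict
      _ ≤ ‖f‖ₑ * (ENNReal.ofReal (R ^ ((d : ℝ) / 2)) * B) ^ (1 / 2 : ℝ) := by
        rw [Measure.restrict_apply_univ, hvol]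
        refine mul_le_mul' ?_ (le_of_eq (by norm_num))
        refine (eLpNorm_mono_measure _ Measure.restrict_le_self).trans (le_of_eq ?_)
        rw [← Lp.enorm_def, ← ofReal_norm, Lp.norm_fourier_eq, ofReal_norm]
      _ = _ := by
        rw [ENNReal.mul_rpow_of_nonneg _ _ (by norm_num),
          ENNReal.ofReal_rpow_of_nonneg (by positivity) (by norm_num),
          ← Real.rpow_mul (by linarith)]
        rw [show (d : ℝ) / 2 * (1 / 2) = d / 4 by ring]
        ring
  have hint : Integrable (𝓕 f : L2 d) volume := by
    rw [← memLp_one_iff_integrable]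
    refine ⟨Lp.aestronglyMeasurable _, h1.trans_lt ?_⟩
    exact ENNReal.mul_lt_top (ENNReal.mul_lt_top
      (ENNReal.rpow_lt_top_of_nonneg (by norm_num) hB) ENNReal.ofReal_lt_top) enorm_lt_top
  filter_upwards [enorm_le_eLpNorm_fourier f hint] with x hx
  exact hx.trans h1

/-- Truncation of `v` at height `N`: below it `v y ≤ N y`, above it `v² ≤ N^(2-p) v^p` because `2 -
p ≤ 0`. -/
theorem enorm_sq_mul_le {v y M N : ℝ≥0∞} {p : ℝ} (hp : 2 ≤ p) (hN : N ≠ 0)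
    (hv : v ≠ ∞) (hy : y ≤ M) :
    (v * y) ^ (2 : ℝ) ≤ N ^ (2 : ℝ) * y ^ (2 : ℝ) + M ^ (2 : ℝ) * N ^ (2 - p) * v ^ p := by
  rw [ENNReal.mul_rpow_of_nonneg _ _ (by norm_num)]
  rcases le_total v N with h | h
  · refine le_add_right ?_
    gcongr
  · refine le_add_left ?_
    have hv0 : v ≠ 0 := (pos_iff_ne_zero.mpr hN |>.trans_le h).ne'
    have h1 : v ^ (2 : ℝ) = v ^ (2 - p) * v ^ p := by
      rw [← ENNReal.rpow_add _ _ hv0 hv, sub_add_cancel]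
    have h2 : v ^ (2 - p) ≤ N ^ (2 - p) := by
      rw [← neg_sub p 2, ENNReal.rpow_neg, ENNReal.rpow_neg, ENNReal.inv_le_inv]
      exact ENNReal.rpow_le_rpow h (by linarith)
    calc v ^ (2 : ℝ) * y ^ (2 : ℝ) ≤ (N ^ (2 - p) * v ^ p) * M ^ (2 : ℝ) := by
          rw [h1]; gcongr
      _ = _ := by ring

/-- Bernstein bounds `f` pointwise by `M = K R^(d/4) ‖f‖`. Truncating `V` at `N = R^(d/(2p))`
balances the two terms of `enorm_sq_mul_le`, both then of order `N² ‖f‖²`. So `θ = d/(2p)`, and `θ <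
1` is the hypothesis `p > d/2`; for `p = ∞`, `θ = 0` works. -/
theorem exists_eLpNorm_mul_le_of_fourier_support {p : ℝ≥0∞} (hpd : (d : ℝ≥0∞) / 2 < p)
    (hp2 : 2 ≤ p) {V : 𝔼 → ℝ} (hV : MemLp V p volume) :
    ∃ θ : ℝ, 0 ≤ θ ∧ θ < 1 ∧ ∃ C : ℝ, 0 ≤ C ∧ ∀ (f : L2 d) (R : ℝ), 1 ≤ R →
      (∀ᵐ ξ, (𝓕 f : L2 d) ξ ≠ 0 → 1 + ‖ξ‖ ^ 2 ≤ R) →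
        eLpNorm (fun x => (V x : ℂ) * f x) 2 volume ≤ ENNReal.ofReal (C * R ^ θ * ‖f‖) := by
  rcases eq_or_ne p ∞ with rfl | hp
  · refine ⟨0, le_rfl, one_pos, (eLpNorm V ∞ volume).toReal, ENNReal.toReal_nonneg,
      fun f R _ _ => ?_⟩
    have h1 := eLpNorm_smul_le_eLpNorm_top_mul_eLpNorm 2 (Lp.aestronglyMeasurable f) V
    rw [Real.rpow_zero, mul_one, ENNReal.ofReal_mul ENNReal.toReal_nonneg,
      ENNReal.ofReal_toReal hV.2.ne, ofReal_norm, Lp.enorm_def]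
    refine le_trans (le_of_eq ?_) h1
    congr 1
  have hp2' : 2 ≤ p.toReal := by
    simpa using (ENNReal.toReal_le_toReal (by norm_num) hp).mpr hp2
  have hpd' : (d : ℝ) / 2 < p.toReal := by
    simpa using (ENNReal.toReal_lt_toReal
      (ENNReal.div_ne_top (ENNReal.natCast_ne_top d) (by norm_num)) hp).mpr hpd
  set q := p.toReal with hq
  obtain ⟨K, hK, hKf⟩ := exists_enorm_le_of_fourier_support d
  let W : ℝ≥0∞ := ∫⁻ x, ‖V x‖ₑ ^ q
  have hW : W ≠ ∞ :=
    ((eLpNorm_lt_top_iff_lintegral_rpow_enorm_lt_top (by positivity) hp).mp hV.2).ne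
  let C : ℝ≥0∞ := (1 + K ^ (2 : ℝ) * W) ^ (1 / 2 : ℝ)
  have hC : C ≠ ∞ := ENNReal.rpow_ne_top_of_nonneg (by norm_num) <| ENNReal.add_ne_top.mpr
    ⟨ENNReal.one_ne_top, ENNReal.mul_ne_top (ENNReal.rpow_ne_top_of_nonneg (by norm_num) hK) hW⟩
  refine ⟨d / (2 * q), by positivity, ?_, C.toReal, ENNReal.toReal_nonneg, fun f R hR hf => ?_⟩
  · rw [div_lt_one (by positivity)]; linarith
  have hR0 : 0 < R := by linarith
  let N : ℝ≥0∞ := ENNReal.ofReal (R ^ ((d : ℝ) / (2 * q)))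
  have hN : N ≠ 0 := by simp only [N, ne_eq, ENNReal.ofReal_eq_zero, not_le]; positivity
  let M : ℝ≥0∞ := K * ENNReal.ofReal (R ^ ((d : ℝ) / 4)) * ‖f‖ₑ
  have hNM : M ^ (2 : ℝ) * N ^ (2 - q) = K ^ (2 : ℝ) * N ^ (2 : ℝ) * ‖f‖ₑ ^ (2 : ℝ) := by
    have h1 : ENNReal.ofReal (R ^ ((d : ℝ) / 4)) ^ (2 : ℝ) * N ^ (2 - q) = N ^ (2 : ℝ) := by
      simp only [N]
      rw [ENNReal.ofReal_rpow_of_pos (by positivity), ENNReal.ofReal_rpow_of_pos (by positivity),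
        ENNReal.ofReal_rpow_of_pos (by positivity), ← ENNReal.ofReal_mul (by positivity),
        ← Real.rpow_mul hR0.le, ← Real.rpow_mul hR0.le, ← Real.rpow_mul hR0.le,
        ← Real.rpow_add hR0]
      congr 2
      field_simp
      ring
    simp only [M]
    rw [ENNReal.mul_rpow_of_nonneg _ _ (by norm_num), ENNReal.mul_rpow_of_nonneg _ _ (by norm_num),
      ← h1]
    ring
  have hf2 : ∫⁻ x, ‖f x‖ₑ ^ (2 : ℝ) = ‖f‖ₑ ^ (2 : ℝ) := by
    rw [Lp.enorm_def, eLpNorm_eq_lintegral_rpow_enorm_toReal (by norm_num) (by norm_num),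
      ← ENNReal.rpow_mul]
    norm_num
  have hle : ∫⁻ x, ‖(V x : ℂ) * f x‖ₑ ^ (2 : ℝ) ≤
      (1 + K ^ (2 : ℝ) * W) * N ^ (2 : ℝ) * ‖f‖ₑ ^ (2 : ℝ) := by
    have hm : AEMeasurable (fun x => ‖f x‖ₑ) volume := (Lp.aestronglyMeasurable f).enorm
    calc ∫⁻ x, ‖(V x : ℂ) * f x‖ₑ ^ (2 : ℝ)
        ≤ ∫⁻ x, (N ^ (2 : ℝ) * ‖f x‖ₑ ^ (2 : ℝ) + M ^ (2 : ℝ) * N ^ (2 - q) * ‖V x‖ₑ ^ q) := by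
          apply lintegral_mono_ae
          filter_upwards [hKf f R hR hf] with x hx
          rw [enorm_mul, ← ofReal_norm (V x : ℂ), Complex.norm_real, ofReal_norm]
          exact enorm_sq_mul_le hp2' hN enorm_ne_top hx
      _ = N ^ (2 : ℝ) * ‖f‖ₑ ^ (2 : ℝ) + M ^ (2 : ℝ) * N ^ (2 - q) * W := by
          rw [lintegral_add_left' ((hm.pow_const _).const_mul _),
            lintegral_const_mul'' _ (hm.pow_const _), hf2,
            lintegral_const_mul'' _ (hV.1.enorm.pow_const _)]
      _ = _ := by rw [hNM]; ring
  calc eLpNorm (fun x => (V x : ℂ) * f x) 2 volume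
      = (∫⁻ x, ‖(V x : ℂ) * f x‖ₑ ^ (2 : ℝ)) ^ (1 / 2 : ℝ) := by
        rw [eLpNorm_eq_lintegral_rpow_enorm_toReal (by norm_num) (by norm_num)]
        norm_num
    _ ≤ ((1 + K ^ (2 : ℝ) * W) * N ^ (2 : ℝ) * ‖f‖ₑ ^ (2 : ℝ)) ^ (1 / 2 : ℝ) := by
        gcongr
    _ = C * N * ‖f‖ₑ := by
        rw [ENNReal.mul_rpow_of_nonneg _ _ (by norm_num),
          ENNReal.mul_rpow_of_nonneg _ _ (by norm_num), ← ENNReal.rpow_mul, ← ENNReal.rpow_mul]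
        norm_num [C]
    _ = _ := by
        rw [ENNReal.ofReal_mul (by positivity), ENNReal.ofReal_mul ENNReal.toReal_nonneg,
          ENNReal.ofReal_toReal hC, ofReal_norm]

end Potential

/-! ### Dyadic decomposition and the relative bound for the potential -/

section RelativeBound

open FourierTransform Real

variable {d : ℕ}

local notation "𝔼" => EuclideanSpace ℝ (Fin d)

theorem measurableSet_lowFrequencies (r : ℝ) : MeasurableSet {ξ : 𝔼 | 1 + ‖ξ‖ ^ 2 < r} :=
  (isOpen_lt (by fun_prop) continuous_const).measurableSet

/-- The projection onto the frequencies with `1 + ‖ξ‖ ^ 2 < r`. -/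
noncomputable def lowFrequency (r : ℝ) (u : L2 d) : L2 d :=
  𝓕⁻ ((Lp.memLp (𝓕 u : L2 d)).indicator (measurableSet_lowFrequencies r)).toLp

theorem fourier_lowFrequency (r : ℝ) (u : L2 d) :
    ∀ᵐ ξ, (𝓕 (lowFrequency r u) : L2 d) ξ =
      {ξ : 𝔼 | 1 + ‖ξ‖ ^ 2 < r}.indicator (𝓕 u : L2 d) ξ := by
  rw [lowFrequency, fourier_fourierInv_eq]
  exact MemLp.coeFn_toLp _

theorem fourier_sub_ae (u v : L2 d) :
    ∀ᵐ ξ, (𝓕 (u - v) : L2 d) ξ = (𝓕 u : L2 d) ξ - (𝓕 v : L2 d) ξ := by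
  rw [show 𝓕 (u - v) = 𝓕 u - 𝓕 v from (Lp.fourierTransformₗᵢ 𝔼 ℂ).map_sub u v]
  exact Lp.coeFn_sub _ _

theorem norm_lowFrequency_le (r : ℝ) (u : L2 d) : ‖lowFrequency r u‖ ≤ ‖u‖ := by
  rw [← one_mul ‖u‖]
  apply norm_fourier_le
  filter_upwards [fourier_lowFrequency r u] with ξ h
  rw [h, one_mul]
  exact norm_indicator_le_norm_self _ _

/-- The function `(1 - (2π)⁻² Δ) u`. -/
noncomputable def bessel (u : H2 d) : L2 d :=
  (u : L2 d) - (((2 * π) ^ 2)⁻¹ : ℂ) • laplacianFun u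

theorem fourier_bessel (u : H2 d) :
    ∀ᵐ ξ, (𝓕 (bessel u) : L2 d) ξ = ((1 + ‖ξ‖ ^ 2 : ℝ) : ℂ) * (𝓕 (u : L2 d) : L2 d) ξ := by
  filter_upwards [fourier_sub_ae (u : L2 d) ((((2 * π) ^ 2)⁻¹ : ℂ) • laplacianFun u),
    fourier_laplacian u, Lp.coeFn_smul (((2 * π) ^ 2)⁻¹ : ℂ) (𝓕 (laplacianFun u) : L2 d)]
    with ξ h1 h2 h3
  rw [bessel, h1, fourier_smul, h3, Pi.smul_apply, h2]
  have : (π : ℂ) ≠ 0 := by exact_mod_cast pi_ne_zero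
  push_cast
  rw [smul_eq_mul]
  field_simp
  ring

theorem norm_bessel_le (u : H2 d) : ‖bessel u‖ ≤ ‖(u : L2 d)‖ + ‖laplacianFun u‖ := by
  refine (norm_sub_le _ _).trans (add_le_add_right ?_ _)
  rw [norm_smul]
  refine mul_le_of_le_one_left (norm_nonneg _) ?_
  rw [norm_inv, norm_pow, norm_mul, Complex.norm_real, Complex.norm_two, norm_of_nonneg pi_pos.le]
  exact inv_le_one_of_one_le₀ (by nlinarith [pi_gt_three])

/-- On the frequencies kept, `|û| ≤ r⁻¹ (1 + |ξ|²) |û|`. This serves both the tail of `u` and the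
dyadic shells. -/
theorem norm_le_of_highFrequency (u : H2 d) {f : L2 d} {r : ℝ} (hr : 0 < r)
    (h : ∀ᵐ ξ, (𝓕 f : L2 d) ξ = 0 ∨ r ≤ 1 + ‖ξ‖ ^ 2 ∧ (𝓕 f : L2 d) ξ = (𝓕 (u : L2 d) : L2 d) ξ) :
    ‖f‖ ≤ r⁻¹ * ‖bessel u‖ := by
  apply norm_fourier_le
  filter_upwards [h, fourier_bessel u] with ξ h1 h2
  rw [h2, norm_mul, Complex.norm_real, Real.norm_eq_abs, abs_of_nonneg (by positivity)]
  rcases h1 with h1 | ⟨h1, h3⟩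
  · rw [h1, norm_zero]; positivity
  · rw [h3, le_inv_mul_iff₀ hr]
    gcongr

theorem norm_sub_lowFrequency_le (u : H2 d) {r : ℝ} (hr : 0 < r) :
    ‖lowFrequency r (u : L2 d) - u‖ ≤ r⁻¹ * ‖bessel u‖ := by
  rw [norm_sub_rev]
  apply norm_le_of_highFrequency u hr
  filter_upwards [fourier_sub_ae (u : L2 d) (lowFrequency r u),
    fourier_lowFrequency r (u : L2 d)] with ξ h1 h2
  by_cases h : 1 + ‖ξ‖ ^ 2 < r
  · left; rw [h1, h2, Set.indicator_of_mem (by exact h), sub_self]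
  · right; rw [h1, h2, Set.indicator_of_notMem (by exact h), sub_zero]
    exact ⟨not_lt.mp h, rfl⟩

theorem fourier_lowFrequency_sub (u : L2 d) {r s : ℝ} (hrs : r ≤ s) :
    ∀ᵐ ξ, (𝓕 (lowFrequency s u - lowFrequency r u) : L2 d) ξ = 0 ∨
      (r ≤ 1 + ‖ξ‖ ^ 2 ∧ 1 + ‖ξ‖ ^ 2 < s) ∧
        (𝓕 (lowFrequency s u - lowFrequency r u) : L2 d) ξ = (𝓕 u : L2 d) ξ := by
  filter_upwards [fourier_sub_ae (lowFrequency s u) (lowFrequency r u),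
    fourier_lowFrequency r u, fourier_lowFrequency s u] with ξ h1 h2 h3
  rw [h1, h2, h3]
  by_cases hr : 1 + ‖ξ‖ ^ 2 < r
  · left
    rw [Set.indicator_of_mem (by exact hr.trans_le hrs), Set.indicator_of_mem (by exact hr),
      sub_self]
  by_cases hs : 1 + ‖ξ‖ ^ 2 < s
  · right
    rw [Set.indicator_of_mem (by exact hs), Set.indicator_of_notMem (by exact hr), sub_zero]
    exact ⟨⟨not_lt.mp hr, hs⟩, rfl⟩
  · left
    rw [Set.indicator_of_notMem (by exact hs), Set.indicator_of_notMem (by exact hr), sub_zero]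

/-- Multiplication by a function is lower semicontinuous along sequences in `L²`. -/
theorem eLpNorm_mul_le_of_tendsto {V : 𝔼 → ℝ} (hV : AEStronglyMeasurable V volume)
    {w : ℕ → L2 d} {u : L2 d} (hw : Tendsto w atTop (𝓝 u)) {c : ℝ≥0∞}
    (hc : ∀ n, eLpNorm (fun x => (V x : ℂ) * w n x) 2 volume ≤ c) :
    eLpNorm (fun x => (V x : ℂ) * u x) 2 volume ≤ c := by
  -- A subsequence converges almost everywhere, and Fatou's lemma applies along it.
  have h1 : TendstoInMeasure volume (fun n => (w n : 𝔼 → ℂ)) atTop u :=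
    tendstoInMeasure_of_tendsto_Lp hw
  obtain ⟨ns, -, hns⟩ := h1.exists_seq_tendsto_ae
  refine (Lp.eLpNorm_lim_le_liminf_eLpNorm (f := fun k x => (V x : ℂ) * w (ns k) x)
    (fun k => (Complex.continuous_ofReal.comp_aestronglyMeasurable hV).mul
      (Lp.aestronglyMeasurable _)) _ ?_).trans ?_
  · filter_upwards [hns] with x hx
    exact hx.const_mul _
  · exact liminf_le_of_frequently_le' (Frequently.of_forall fun k => hc (ns k))

/-- The multiplication by `V` is infinitesimally bounded with respect to the Laplacian. -/
theorem exists_eLpNorm_mul_le {p : ℝ≥0∞} (hpd : (d : ℝ≥0∞) / 2 < p)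
    (hp2 : 2 ≤ p) {V : 𝔼 → ℝ} (hV : MemLp V p volume) :
    ∃ b : ℝ, 0 ≤ b ∧ ∀ u : H2 d, eLpNorm (fun x => (V x : ℂ) * (u : L2 d) x) 2 volume ≤
      ENNReal.ofReal (1 / 2 * ‖laplacianFun u‖ + b * ‖(u : L2 d)‖) := by
  obtain ⟨θ, hθ0, hθ1, C, hC, hK⟩ := exists_eLpNorm_mul_le_of_fourier_support hpd hp2 hV
  set a : ℝ := 2 ^ θ with ha
  have ha0 : 0 < a := by positivity
  have ha2 : a < 2 := by
    simpa using Real.rpow_lt_rpow_of_exponent_lt one_lt_two hθ1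
  have hpow (k : ℕ) : ((2 : ℝ) ^ k) ^ θ = a ^ k := Real.rpow_pow_comm (by norm_num) θ k |>.symm
  set ρ := a / 2 with hρ
  have hρ0 : 0 < ρ := by positivity
  have hρ1 : ρ < 1 := by rw [hρ]; linarith
  -- `J` makes the geometric tail `C a ρ^J / (1 - ρ)` at most `1/2`; the `+ 1` keeps the denominator
  -- positive if `C = 0`.
  obtain ⟨J, hJ⟩ := exists_pow_lt_of_lt_one
    (show 0 < (1 - ρ) / (2 * (C * a + 1)) from div_pos (by linarith) (by positivity)) hρ1
  -- `C a^J` comes from the frequencies below `2^J`, and `1/2` from the `‖u‖` part of `‖bessel u‖`.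
  refine ⟨C * a ^ J + 1 / 2, by positivity, fun u => ?_⟩
  let w : ℕ → L2 d := fun m => lowFrequency (2 ^ (J + m)) u
  have hw : Tendsto w atTop (𝓝 u) := by
    rw [tendsto_iff_norm_sub_tendsto_zero]
    refine squeeze_zero (fun _ => norm_nonneg _)
      (fun m => norm_sub_lowFrequency_le u (by positivity)) ?_
    rw [← zero_mul ‖bessel u‖]
    refine Tendsto.mul_const _ (tendsto_inv_atTop_zero.comp ?_)
    exact (tendsto_pow_atTop_atTop_of_one_lt one_lt_two).comp
      (tendsto_atTop_mono (fun m => Nat.le_add_left m J) tendsto_id)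
  have hw0 : eLpNorm (fun x => (V x : ℂ) * w 0 x) 2 volume ≤
      ENNReal.ofReal (C * a ^ J * ‖(u : L2 d)‖) := by
    refine (hK (w 0) (2 ^ J) (one_le_pow₀ one_le_two) ?_).trans (ENNReal.ofReal_le_ofReal ?_)
    · filter_upwards [fourier_lowFrequency (2 ^ (J + 0)) (u : L2 d)] with ξ h1 h2
      rw [h1] at h2
      have h3 : ξ ∈ {ξ : 𝔼 | 1 + ‖ξ‖ ^ 2 < 2 ^ (J + 0)} := Set.mem_of_indicator_ne_zero h2
      exact (show 1 + ‖ξ‖ ^ 2 < 2 ^ (J + 0) from h3).le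
    · rw [hpow]
      gcongr
      exact norm_lowFrequency_le _ _
  -- On this shell `V` costs `C a^(J+m+1)` and the weight gains `2^(-(J+m))`; the product is `C a
  -- ρ^(J+m)`.
  have hstep (m : ℕ) : eLpNorm (fun x => (V x : ℂ) * (w (m + 1) - w m : L2 d) x) 2 volume ≤
      ENNReal.ofReal (C * a * ρ ^ J * ρ ^ m * ‖bessel u‖) := by
    have h0 := fourier_lowFrequency_sub (u : L2 d) (r := 2 ^ (J + m)) (s := 2 ^ (J + (m + 1)))
      (pow_le_pow_right₀ one_le_two (by omega))
    refine (hK _ (2 ^ (J + (m + 1))) (one_le_pow₀ one_le_two) ?_).trans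
      (ENNReal.ofReal_le_ofReal ?_)
    · filter_upwards [h0] with ξ h1 h2
      exact (h1.resolve_left h2).1.2.le
    · have h1 : ‖w (m + 1) - w m‖ ≤ (2 ^ (J + m))⁻¹ * ‖bessel u‖ := by
        apply norm_le_of_highFrequency u (by positivity)
        filter_upwards [h0] with ξ h1
        exact h1.imp_right fun h => ⟨h.1.1, h.2⟩
      rw [hpow]
      calc C * a ^ (J + (m + 1)) * ‖w (m + 1) - w m‖
          ≤ C * a ^ (J + (m + 1)) * ((2 ^ (J + m))⁻¹ * ‖bessel u‖) := by gcongr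
        _ = _ := by rw [hρ, div_pow, div_pow]; field_simp; ring
  have hsum (m : ℕ) : eLpNorm (fun x => (V x : ℂ) * w m x) 2 volume ≤
      ENNReal.ofReal (C * a ^ J * ‖(u : L2 d)‖ +
        C * a * ρ ^ J * (∑ i ∈ Finset.range m, ρ ^ i) * ‖bessel u‖) := by
    induction m with
    | zero => simpa using hw0
    | succ m ih =>
      have hmeas (f : L2 d) : AEStronglyMeasurable (fun x => (V x : ℂ) * f x) volume :=
        (Complex.continuous_ofReal.comp_aestronglyMeasurable hV.1).mul (Lp.aestronglyMeasurable _)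
      have h1 : (fun x => (V x : ℂ) * w (m + 1) x) =ᵐ[volume]
          (fun x => (V x : ℂ) * w m x) + fun x => (V x : ℂ) * (w (m + 1) - w m : L2 d) x := by
        filter_upwards [Lp.coeFn_sub (w (m + 1)) (w m)] with x hx
        rw [Pi.add_apply, hx, Pi.sub_apply]
        ring
      rw [eLpNorm_congr_ae h1]
      refine (eLpNorm_add_le (hmeas _) (hmeas _) (by norm_num)).trans
        ((add_le_add ih (hstep m)).trans (le_of_eq ?_))
      rw [← ENNReal.ofReal_add (by positivity) (by positivity), Finset.sum_range_succ]
      congr 1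
      ring
  -- Lower semicontinuity is needed since `V u ∈ L²` is not yet known.
  refine eLpNorm_mul_le_of_tendsto hV.1 hw fun m => (hsum m).trans (ENNReal.ofReal_le_ofReal ?_)
  have h1 : ∑ i ∈ Finset.range m, ρ ^ i ≤ (1 - ρ)⁻¹ :=
    sum_le_hasSum _ (fun i _ => by positivity) (hasSum_geometric_of_lt_one hρ0.le hρ1)
  have h2 : C * a * ρ ^ J * (∑ i ∈ Finset.range m, ρ ^ i) ≤ 1 / 2 := by
    have h3 : (0 : ℝ) < 1 - ρ := by linarith
    rw [lt_div_iff₀ (by positivity)] at hJ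
    calc C * a * ρ ^ J * (∑ i ∈ Finset.range m, ρ ^ i) ≤ C * a * ρ ^ J * (1 - ρ)⁻¹ := by gcongr
      _ ≤ 1 / 2 := by
        rw [← div_eq_mul_inv, div_le_iff₀ h3]
        linarith [pow_pos hρ0 J]
  calc C * a ^ J * ‖(u : L2 d)‖ + C * a * ρ ^ J * (∑ i ∈ Finset.range m, ρ ^ i) * ‖bessel u‖
      ≤ C * a ^ J * ‖(u : L2 d)‖ + 1 / 2 * (‖(u : L2 d)‖ + ‖laplacianFun u‖) := by
        gcongr
        exact norm_bessel_le u
    _ = _ := by ring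

theorem norm_freeOperator_apply (u : (freeOperator d).domain) :
    ‖freeOperator d u‖ = ‖laplacianFun u‖ := by
  change ‖Complex.I • laplacianFun u‖ = _
  rw [norm_smul, Complex.norm_I, one_mul]

theorem norm_smul_potentialOperator_apply {V : 𝔼 → ℝ}
    (u : (Complex.I • potentialOperator V).domain) :
    ‖(Complex.I • potentialOperator V) u‖ =
      (eLpNorm (fun x => (V x : ℂ) * (u : L2 d) x) 2 volume).toReal := by
  change ‖Complex.I • (memLp_of_mem_potentialDomain u).toLp‖ = _
  rw [norm_smul, Complex.norm_I, one_mul, Lp.norm_toLp]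

end RelativeBound

end Schrodinger

/-! ### Conclusion for the Schrödinger operator -/

theorem mainTheorem5 (d : ℕ) (p : ℝ≥0∞) (hpd : (d : ℝ≥0∞) / 2 < p) (hp2 : 2 ≤ p)
    (V : EuclideanSpace ℝ (Fin d) → ℝ) (hV : MemLp V p volume) :
    (Schrodinger.schrodingerOperator V).domain = Schrodinger.H2 d ∧
      ∃ U : ℝ → Schrodinger.L2 d →L[ℂ] Schrodinger.L2 d,
        Schrodinger.IsUnitaryGroup U ∧
          Schrodinger.IsInfinitesimalGenerator (Schrodinger.schrodingerOperator V) U := by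
  obtain ⟨b, hb, hVb⟩ := Schrodinger.exists_eLpNorm_mul_le hpd hp2 hV
  have hdom : Schrodinger.H2 d ≤ Schrodinger.potentialDomain V := fun u hu =>
    ⟨(Complex.continuous_ofReal.comp_aestronglyMeasurable hV.1).mul (Lp.aestronglyMeasurable _),
      (hVb ⟨u, hu⟩).trans_lt ENNReal.ofReal_lt_top⟩
  refine ⟨inf_eq_left.mpr hdom, ?_⟩
  have hT := Schrodinger.isSkewSymmetric_freeOperator d
  -- `4 b + 1` is the threshold from Kato–Rellich, with `T = iΔ` and `S = iV`.
  refine (hT.sub (Schrodinger.isSkewSymmetric_potentialOperator V)).exists_isUnitaryGroup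
    (c₀ := 4 * b + 1) (by positivity) fun c hc y => ?_
  refine hT.exists_smul_sub_eq (S := Complex.I • Schrodinger.potentialOperator V)
    (fun c hc y => Schrodinger.freeOperator_surjective hc y) hdom (fun u => ?_) hb hc y
  rw [Schrodinger.norm_freeOperator_apply, Schrodinger.norm_smul_potentialOperator_apply]
  exact ENNReal.toReal_le_of_le_ofReal (by positivity) (hVb u)
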